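/- Let $\mathcal H$ be a complex Hilbert space, write $A>0$ for a bounded positive invertible operator $A$ on $\mathcal H$, and for $X>0$ let $\|X\|_\infty$ be the operator norm of $X$ and $\lambda_{\min}(X)$ the minimum of the spectrum of $X$. Let $\mathrm{OM}_+^1$ be the set of continuous functions $h:(0,\infty)\to(0,\infty)$ with $h(1)=1$ that are operator monotone, i.e. $0<A\le B$ implies $h(A)\le h(B)$ for bounded operators $A,B$ on an arbitrary Hilbert space. For $h\in\mathrm{OM}_+^1$ and $A,B>0$ put $A\sigma_hB:=A^{1/2}h(A^{-1/2}BA^{-1/2})A^{1/2}$. **Theorem.** Let $h\in\mathrm{OM}_+^1$, let $A,B>0$, and set $C:=A^{-1/2}BA^{-1/2}$. Then for every $p$ with $1\le p\le2$, $$\lambda_{\min}\Bigl(\frac{h(C^p)}{h(C)^p}\Bigr)\,\lambda_{\min}^{p-1}(A\sigma_hB)\,(A\sigma_hB)\ \le\ A^p\sigma_hB^p\ \le\ \Bigl\|\frac{h(C^p)}{h(C)^p}\Bigr\|_\infty\,\|A\sigma_hB\|_\infty^{p-1}\,(A\sigma_hB),$$ and for every $p$ with $0<p\le1$, $$\lambda_{\min}\Bigl(\frac{h(C^p)}{h(C)^p}\Bigr)\,\|A\sigma_hB\|_\infty^{p-1}\,(A\sigma_hB)\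 \le\ A^p\sigma_hB^p\ \le\ \Bigl\|\frac{h(C^p)}{h(C)^p}\Bigr\|_\infty\,\lambda_{\min}^{p-1}(A\sigma_hB)\,(A\sigma_hB).$$ -/

import Mathlib

universe u

/-- A real function `f` on `(0, ∞)` is operator monotone: it is continuous there, and
`0 < A ≤ B` implies `f(A) ≤ f(B)` for bounded operators `A, B` on any complex Hilbert space.
(The values of `f` outside `(0, ∞)` play no role.) -/
structure IsOperatorMonotone (f : ℝ → ℝ) : Prop where
  continuousOn : ContinuousOn f (Set.Ioi 0)
  mono : ∀ (K : Type u) [NormedAddCommGroup K] [InnerProductSpace ℂ K] [CompleteSpace K]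
    (A B : K →L[ℂ] K), IsStrictlyPositive A → A ≤ B → cfc f A ≤ cfc f B

/-- The class `OM₊¹` of positive operator monotone functions `h` on `(0, ∞)` with `h(1) = 1`. -/
structure IsOMPlusOne (h : ℝ → ℝ) : Prop where
  operatorMonotone : IsOperatorMonotone.{u} h
  pos : ∀ t : ℝ, 0 < t → 0 < h t
  map_one : h 1 = 1

section

variable {H : Type u} [NormedAddCommGroup H] [InnerProductSpace ℂ H] [CompleteSpace H]

/-- The operator perspective `P_f(A, B) = B^{1/2} f(B^{-1/2} A B^{-1/2}) B^{1/2}`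
for positive invertible `A, B`. -/
noncomputable def operatorPerspective (f : ℝ → ℝ) (A B : H →L[ℂ] H) : H →L[ℂ] H :=
  B ^ (1 / 2 : ℝ) * cfc f (B ^ (-(1 / 2) : ℝ) * A * B ^ (-(1 / 2) : ℝ)) * B ^ (1 / 2 : ℝ)

/-- The operator mean `A σ_h B = P_h(B, A) = A^{1/2} h(A^{-1/2} B A^{-1/2}) A^{1/2}`
with representing function `h`, for positive invertible `A, B`. -/
noncomputable def operatorMean (h : ℝ → ℝ) (A B : H →L[ℂ] H) : H →L[ℂ] H :=
  operatorPerspective h B A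

/-- The minimum of the spectrum of a positive invertible operator. -/
noncomputable def lambdaMin (X : H →L[ℂ] H) : ℝ :=
  sInf (spectrum ℝ X)

/-- The quotient `h(C^p) / h(C)^p = h(C^p) h(C)^{-p}`, where `C` is positive invertible and
`h > 0` on `(0, ∞)`; the two factors commute. -/
noncomputable def powerQuotient (h : ℝ → ℝ) (p : ℝ) (C : H →L[ℂ] H) : H →L[ℂ] H :=
  cfc h (C ^ p) * (cfc h C) ^ (-p)

end

/-! Put q = p - 1 and T = A^{1/2} C^{1/2}, so that B = T T† and T† T = C^{1/2} A C^{1/2}. Since (T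
T†)^{q+1} = T (T† T)^q T†, both A^p and B^p have the form A^{1/2} (·) A^{1/2}, and congruence
invariance of the mean gives A^p σ B^p = A^{1/2} F(A) A^{1/2}, with F(X) = X^q σ C^{1/2} (C^{1/2} X
C^{1/2})^q C^{1/2} (`operatorMean_rpow`, `reducedMean`). As |q| ≤ 1, Löwner–Heinz and joint
monotonicity of σ make F increasing for q ≥ 0 and decreasing for q ≤ 0.

Let M = A σ B = A^{1/2} h(C) A^{1/2}. The bounds λ_min(M) ≤ M ≤ ‖M‖ amount to λ_min(M) h(C)⁻¹ ≤ A ≤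
‖M‖ h(C)⁻¹. Replacing A in F by r h(C)⁻¹ leaves only functions of C, and F becomes r^{p-1} · (h(t^p)
/ h(t)^p) · h(t) at t = C (`reducedMean_cfc`). Bounding the quotient by its extreme values and
conjugating back by A^{1/2} turns the remaining h(C) into M.

Monotonicity of σ in its first argument is the deep ingredient. It follows from Hansen's inequality
(`conj_cfc_le`), which is derived from operator monotonicity on H ⊕ H: a rotated block diagonal
operator is dominated by an unrotated one, and compressing to a corner gives operator concavity up
to a factor that tends to 1. -/

/-! ### Block diagonal operators and their functional calculus -/

lemma StarAlgHom.cfc_map_prod {A B : Type*} [CStarAlgebra A] [CStarAlgebra B]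
    (φ : A × A →⋆ₐ[ℂ] B) (hφ : Continuous φ) (f : ℝ → ℝ) {x y : A}
    (hx : IsSelfAdjoint x) (hy : IsSelfAdjoint y)
    (hf : ContinuousOn f (spectrum ℝ x ∪ spectrum ℝ y)) :
    cfc f (φ (x, y)) = φ (cfc f x, cfc f y) := by
  have hxy : IsSelfAdjoint (x, y) := Prod.ext hx hy
  have : ContinuousFunctionalCalculus ℝ (A × A) IsSelfAdjoint :=
    IsSelfAdjoint.instContinuousFunctionalCalculus
  rw [← _root_.cfc_map_prod (S := ℂ) f x y hf hxy hx hy]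
  exact (φ.map_cfc f (x, y) (by rwa [Prod.spectrum_eq]) hφ hxy
    (hxy.map φ)).symm

open ContinuousLinearMap in
/-- Two isometries `V, W : H → K` with orthogonal ranges spanning `K`. -/
structure IsIsometryPair {H K : Type*} [NormedAddCommGroup H] [InnerProductSpace ℂ H]
    [CompleteSpace H] [NormedAddCommGroup K] [InnerProductSpace ℂ K] [CompleteSpace K]
    (V W : H →L[ℂ] K) : Prop where
  left (x : H) : adjoint V (V x) = x
  right (x : H) : adjoint W (W x) = x
  left_right (x : H) : adjoint V (W x) = 0
  right_left (x : H) : adjoint W (V x) = 0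
  sum (k : K) : V (adjoint V k) + W (adjoint W k) = k

namespace IsIsometryPair

open ContinuousLinearMap

section

variable {H K : Type*} [NormedAddCommGroup H] [InnerProductSpace ℂ H]
  [CompleteSpace H] [NormedAddCommGroup K] [InnerProductSpace ℂ K] [CompleteSpace K]
  {V W : H →L[ℂ] K}

/-- The block diagonal operator `V x V† + W y W†`, as a star homomorphism in `(x, y)`. -/
noncomputable def diag (hVW : IsIsometryPair V W) :
    ((H →L[ℂ] H) × (H →L[ℂ] H)) →⋆ₐ[ℂ] (K →L[ℂ] K) where
  toFun x := V ∘L x.1 ∘L adjoint V + W ∘L x.2 ∘L adjoint W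
  map_one' := by ext k; simpa using hVW.sum k
  map_mul' x y := by
    ext k
    simp [hVW.left, hVW.right, hVW.left_right, hVW.right_left]
  map_zero' := by ext k; simp
  map_add' x y := by ext k; simp; abel
  commutes' r := by
    ext k
    simpa [Algebra.algebraMap_eq_smul_one] using congrArg (r • ·) (hVW.sum k)
  map_star' x := by
    simp [star_eq_adjoint, adjoint_comp, ContinuousLinearMap.comp_assoc]

lemma diag_apply (hVW : IsIsometryPair V W) (x y : H →L[ℂ] H) :
    hVW.diag (x, y) = V ∘L x ∘L adjoint V + W ∘L y ∘L adjoint W := rfl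

lemma continuous_diag (hVW : IsIsometryPair V W) : Continuous hVW.diag := by
  change Continuous fun x : (H →L[ℂ] H) × (H →L[ℂ] H) ↦
    V ∘L x.1 ∘L adjoint V + W ∘L x.2 ∘L adjoint W
  fun_prop

lemma cfc_diag (hVW : IsIsometryPair V W) (f : ℝ → ℝ) {x y : H →L[ℂ] H}
    (hx : IsSelfAdjoint x) (hy : IsSelfAdjoint y)
    (hf : ContinuousOn f (spectrum ℝ x ∪ spectrum ℝ y)) :
    cfc f (hVW.diag (x, y)) = hVW.diag (cfc f x, cfc f y) :=
  hVW.diag.cfc_map_prod hVW.continuous_diag f hx hy hf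

lemma isStrictlyPositive_diag (hVW : IsIsometryPair V W) {x y : H →L[ℂ] H}
    (hx : IsStrictlyPositive x) (hy : IsStrictlyPositive y) :
    IsStrictlyPositive (hVW.diag (x, y)) := by
  refine IsUnit.isStrictlyPositive ((Prod.isUnit_iff.2 ⟨hx.isUnit, hy.isUnit⟩).map hVW.diag) ?_
  rw [diag_apply]
  refine add_nonneg ?_ ?_ <;> rw [nonneg_iff_isPositive]
  · exact ((nonneg_iff_isPositive _).1 hx.nonneg).conj_adjoint V
  · exact ((nonneg_iff_isPositive _).1 hy.nonneg).conj_adjoint W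

/-- Compression by V preserves order and sees only the first block, so an arbitrarily large second
block in the majorant costs nothing. -/
lemma le_of_diag_le (hVW : IsIsometryPair V W) {x y : H →L[ℂ] H} {z : K →L[ℂ] K}
    (hz : z ≤ hVW.diag (x, y)) : adjoint V ∘L z ∘L V ≤ x := by
  have h := (ContinuousLinearMap.le_def _ _).1 hz
  rw [ContinuousLinearMap.le_def]
  convert h.adjoint_conj V using 1
  ext k
  simp [diag_apply, hVW.left, hVW.left_right]

end

section

variable {H : Type*} [NormedAddCommGroup H] [InnerProductSpace ℂ H] [CompleteSpace H]

lemma adjoint_fstL (x : H) :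
    adjoint (WithLp.fstL 2 ℂ H H) x = WithLp.toLp 2 (x, 0) := by
  refine ext_inner_right ℂ fun y ↦ ?_
  simp [adjoint_inner_left, WithLp.prod_inner_apply]

lemma adjoint_sndL (x : H) :
    adjoint (WithLp.sndL 2 ℂ H H) x = WithLp.toLp 2 (0, x) := by
  refine ext_inner_right ℂ fun y ↦ ?_
  simp [adjoint_inner_left, WithLp.prod_inner_apply]

variable (H) in
/-- The two coordinate embeddings of `H` into the Hilbert sum `H ⊕ H`. -/
lemma coordinates :
    IsIsometryPair (adjoint (WithLp.fstL 2 ℂ H H)) (adjoint (WithLp.sndL 2 ℂ H H)) where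
  left x := by simp [adjoint_fstL]
  right x := by simp [adjoint_sndL]
  left_right x := by simp [adjoint_sndL]
  right_left x := by simp [adjoint_fstL]
  sum k := by
    rw [adjoint_adjoint, adjoint_adjoint, adjoint_fstL, adjoint_sndL, ← WithLp.toLp_add]
    exact WithLp.ofLp_injective 2 (by simp; rfl)

variable (H) in
lemma exists_pair : ∃ V W : H →L[ℂ] WithLp 2 (H × H), IsIsometryPair V W :=
  ⟨_, _, coordinates H⟩

end

section

variable {H K : Type*} [NormedAddCommGroup H] [InnerProductSpace ℂ H]
  [CompleteSpace H] [NormedAddCommGroup K] [InnerProductSpace ℂ K] [CompleteSpace K]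
  {V W : H →L[ℂ] K}

/-- The new frame is the old one times the block matrix [[a, b], [b, -a]], which is self-adjoint and
squares to 1 because a and b commute and a² + b² = 1. -/
lemma rotate (hVW : IsIsometryPair V W) {a b : H →L[ℂ] H} (ha : IsSelfAdjoint a)
    (hb : IsSelfAdjoint b) (hab : Commute a b) (hsum : a * a + b * b = 1) :
    IsIsometryPair (V ∘L a + W ∘L b) (V ∘L b - W ∘L a) := by
  have ha' : adjoint a = a := ha
  have hb' : adjoint b = b := hb
  have hs (x : H) : a (a x) + b (b x) = x := congrArg (· x) hsum
  have hc (x : H) : a (b x) = b (a x) := congrArg (· x) hab.eq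
  constructor
  · intro x
    simp [adjoint_comp, ha', hb', hVW.left, hVW.right, hVW.left_right, hVW.right_left, hs]
  · intro x
    simp [adjoint_comp, ha', hb', hVW.left, hVW.right, hVW.left_right, hVW.right_left,
      add_comm, hs]
  · intro x
    simp [adjoint_comp, ha', hb', hVW.left, hVW.right, hVW.left_right, hVW.right_left, hc]
  · intro x
    simp [adjoint_comp, ha', hb', hVW.left, hVW.right, hVW.left_right, hVW.right_left, hc]
  · intro k
    have h1 := congrArg V (hs (adjoint V k))
    have h2 := congrArg W (hs (adjoint W k))
    rw [map_add] at h1 h2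
    conv_rhs => rw [← hVW.sum k, ← h1, ← h2]
    simp [adjoint_comp, ha', hb', hc]
    abel

/-- Off-diagonal blocks are absorbed by the diagonal ones. -/
lemma diag_rotate_le (hVW : IsIsometryPair V W) {a b x y : H →L[ℂ] H} (ha : IsSelfAdjoint a)
    (hb : IsSelfAdjoint b) (hab : Commute a b) (hsum : a * a + b * b = 1)
    (hx : 0 ≤ x) (hy : 0 ≤ y) {r : ℝ} (hr : 0 < r) :
    (hVW.rotate ha hb hab hsum).diag (x, y) ≤
      hVW.diag ((1 + r ^ 2) • (a * x * a + b * y * b),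
        (1 + (r⁻¹) ^ 2) • (b * x * b + a * y * a)) := by
  have ha' : adjoint a = a := ha
  have hb' : adjoint b = b := hb
  -- The difference of the two sides is exactly L x L† + M y M† with L = r V a - r⁻¹ W b and M = r V
  -- b + r⁻¹ W a. The cross terms cancel those of the rotated operator, and the squares supply the
  -- weights r² and r⁻².
  have h1 := ((nonneg_iff_isPositive _).1 hx).conj_adjoint
    ((r : ℂ) • (V ∘L a) - ((r : ℂ)⁻¹) • (W ∘L b))
  have h2 := ((nonneg_iff_isPositive _).1 hy).conj_adjoint
    ((r : ℂ) • (V ∘L b) + ((r : ℂ)⁻¹) • (W ∘L a))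
  rw [ContinuousLinearMap.le_def]
  convert h1.add h2 using 1
  have hr' : (r : ℂ) ≠ 0 := by exact_mod_cast hr.ne'
  ext k
  simp only [diag_apply, ← Complex.coe_smul]
  simp [adjoint_comp, ha', hb', smul_smul, smul_sub, smul_add, map_smulₛₗ, -Complex.coe_smul]
  match_scalars <;> field_simp <;> ring

end

end IsIsometryPair

open ContinuousLinearMap in
/-- An operator intertwining two self-adjoint operators intertwines their functional calculi. -/
lemma cfc_mul_eq_mul_cfc_of_intertwine {H : Type*} [NormedAddCommGroup H] [InnerProductSpace ℂ H]
    [CompleteSpace H] (f : ℝ → ℝ) {x y t : H →L[ℂ] H} (hx : IsSelfAdjoint x)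
    (hy : IsSelfAdjoint y) (hf : ContinuousOn f (spectrum ℝ x ∪ spectrum ℝ y))
    (h : x * t = t * y) : cfc f x * t = t * cfc f y := by
  obtain ⟨V, W, hVW⟩ := IsIsometryPair.exists_pair H
  have hp (v : H) : x (t v) = t (y v) := congrArg (· v) h
  -- Placing t in the off-diagonal corner turns intertwining into commutation with diag(x, y), which
  -- the functional calculus preserves.
  have hcomm : Commute (hVW.diag (x, y)) (V ∘L t ∘L adjoint W) := by
    ext k
    simp [IsIsometryPair.diag_apply, hVW.left, hVW.right, hVW.right_left, hp]
  have := (hcomm.cfc_real f).eq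
  rw [hVW.cfc_diag f hx hy hf] at this
  ext v
  have h3 := congrArg (fun z ↦ adjoint V (z (W v))) this
  simpa [IsIsometryPair.diag_apply, hVW.left, hVW.right, hVW.left_right, hVW.right_left] using h3

/-! ### Operator concavity and Hansen's inequality -/

section

variable {H : Type u} [NormedAddCommGroup H] [InnerProductSpace ℂ H] [CompleteSpace H]

lemma IsStrictlyPositive.spectrum_subset_Ioi {a : H →L[ℂ] H} (ha : IsStrictlyPositive a) :
    spectrum ℝ a ⊆ Set.Ioi 0 := fun _ hx ↦ ha.spectrum_pos hx

lemma IsStrictlyPositive.exists_algebraMap_le {a : H →L[ℂ] H} (ha : IsStrictlyPositive a) :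
    ∃ r > 0, algebraMap ℝ (H →L[ℂ] H) r ≤ a := by
  obtain h | h := subsingleton_or_nontrivial (H →L[ℂ] H)
  · exact ⟨1, one_pos, (Subsingleton.elim _ _).le⟩
  · exact (CFC.exists_pos_algebraMap_le_iff ha.isSelfAdjoint).2 fun _ hx ↦ ha.spectrum_pos hx

lemma IsStrictlyPositive.conj_add_conj {a b x y : H →L[ℂ] H} (hx : IsStrictlyPositive x)
    (hy : IsStrictlyPositive y) (ha : IsSelfAdjoint a) (hb : IsSelfAdjoint b)
    (hsum : a * a + b * b = 1) : IsStrictlyPositive (a * x * a + b * y * b) := by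
  obtain ⟨r, hr, hrx⟩ := hx.exists_algebraMap_le
  obtain ⟨s, hs, hsy⟩ := hy.exists_algebraMap_le
  have hrs : 0 < min r s := lt_min hr hs
  refine (isStrictlyPositive_algebraMap hrs).of_le ?_
  calc algebraMap ℝ (H →L[ℂ] H) (min r s)
      = a * algebraMap ℝ _ (min r s) * a + b * algebraMap ℝ _ (min r s) * b := by
        simp [Algebra.algebraMap_eq_smul_one, ← smul_add, hsum]
    _ ≤ a * x * a + b * y * b := add_le_add
        (ha.conjugate_le_conjugate ((algebraMap_mono _ (min_le_left _ _)).trans hrx))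
        (hb.conjugate_le_conjugate ((algebraMap_mono _ (min_le_right _ _)).trans hsy))

namespace IsOperatorMonotone

variable {h : ℝ → ℝ}

lemma continuousOn_spectrum (hh : IsOperatorMonotone.{u} h) {a : H →L[ℂ] H}
    (ha : IsStrictlyPositive a) : ContinuousOn h (spectrum ℝ a) :=
  hh.continuousOn.mono ha.spectrum_subset_Ioi

open ContinuousLinearMap in
/-- Operator concavity of an operator monotone function, up to a factor `1 + r ^ 2`. -/
lemma conj_cfc_add_le (hh : IsOperatorMonotone.{u} h) {a b x y : H →L[ℂ] H}
    (ha : IsSelfAdjoint a) (hb : IsSelfAdjoint b) (hab : Commute a b)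
    (hsum : a * a + b * b = 1) (hx : IsStrictlyPositive x) (hy : IsStrictlyPositive y)
    {r : ℝ} (hr : 0 < r) :
    a * cfc h x * a + b * cfc h y * b ≤ cfc h ((1 + r ^ 2) • (a * x * a + b * y * b)) := by
  have ha' : adjoint a = a := ha
  have hb' : adjoint b = b := hb
  obtain ⟨V, W, hVW⟩ := IsIsometryPair.exists_pair H
  have hVW' := hVW.rotate ha hb hab hsum
  have hZ := hVW'.isStrictlyPositive_diag hx hy
  have hle := hVW.diag_rotate_le ha hb hab hsum hx.nonneg hy.nonneg hr
  have hS := IsStrictlyPositive.of_le hZ hle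
  have hS' : IsStrictlyPositive ((1 + r ^ 2) • (a * x * a + b * y * b)) ∧
      IsStrictlyPositive ((1 + (r⁻¹) ^ 2) • (b * x * b + a * y * a)) :=
    ⟨.smul (by positivity) (hx.conj_add_conj hy ha hb hsum),
      .smul (by positivity) (hx.conj_add_conj hy hb ha (by rwa [add_comm]))⟩
  -- Monotonicity is applied on H ⊕ H rather than H; the V-corner of the result is the claim, and
  -- the block weighted by 1 + r⁻² is discarded.
  have h1 := hh.mono _ _ _ hZ hle
  rw [hVW.cfc_diag h hS'.1.isSelfAdjoint hS'.2.isSelfAdjoint,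
    hVW'.cfc_diag h hx.isSelfAdjoint hy.isSelfAdjoint] at h1
  · have h2 := hVW.le_of_diag_le h1
    convert h2 using 1
    ext v
    simp [IsIsometryPair.diag_apply, adjoint_comp, ha', hb', hVW.left, hVW.left_right, hVW.right_left]
  · exact hh.continuousOn.mono (Set.union_subset hx.spectrum_subset_Ioi hy.spectrum_subset_Ioi)
  · exact hh.continuousOn.mono
      (Set.union_subset hS'.1.spectrum_subset_Ioi hS'.2.spectrum_subset_Ioi)

/-- Scalar dilation tending to `1` from above may be removed from an operator inequality. -/
lemma le_cfc_of_forall_smul (hh : IsOperatorMonotone.{u} h) {x y : H →L[ℂ] H}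
    (hx : IsStrictlyPositive x) (hle : ∀ s : ℝ, 1 < s → y ≤ cfc h (s • x)) : y ≤ cfc h x := by
  obtain ⟨m, hm, hmx⟩ := hx.exists_algebraMap_le
  -- One compact subset of (0, ∞) containing all these spectra makes the functional calculus
  -- continuous in s.
  have hspec : ∀ s ∈ Set.Icc (1 : ℝ) 2, spectrum ℝ (s • x) ⊆ Set.Icc m (2 * ‖x‖) := by
    intro s hs
    have h1 : algebraMap ℝ (H →L[ℂ] H) m ≤ s • x :=
      hmx.trans (le_smul_of_one_le_left hx.nonneg hs.1)
    have h2 : s • x ≤ algebraMap ℝ (H →L[ℂ] H) (2 * ‖x‖) := by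
      calc s • x ≤ (2 : ℝ) • x := smul_le_smul_of_nonneg_right hs.2 hx.nonneg
        _ ≤ (2 : ℝ) • algebraMap ℝ (H →L[ℂ] H) ‖x‖ :=
          smul_le_smul_of_nonneg_left hx.isSelfAdjoint.le_algebraMap_norm_self two_pos.le
        _ = _ := by simp [Algebra.algebraMap_eq_smul_one, smul_smul]
    have hsa : IsSelfAdjoint (s • x) := .smul (.all s) hx.isSelfAdjoint
    intro t ht
    exact ⟨(algebraMap_le_iff_le_spectrum hsa).1 h1 t ht,
      (le_algebraMap_iff_spectrum_le hsa).1 h2 t ht⟩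
  have hev : ∀ᶠ s : ℝ in nhdsWithin 1 (Set.Ioi 1), s ∈ Set.Ioc (1 : ℝ) 2 :=
    Ioc_mem_nhdsGT one_lt_two
  have hlim : Filter.Tendsto (fun s : ℝ ↦ cfc h (s • x)) (nhdsWithin 1 (Set.Ioi 1))
      (nhds (cfc h x)) := by
    refine Filter.Tendsto.cfc (s := Set.Icc m (2 * ‖x‖)) isCompact_Icc h ?_ ?_ ?_ ?_
      hx.isSelfAdjoint (hh.continuousOn.mono fun t ht ↦ hm.trans_le ht.1)
    · have : Filter.Tendsto (fun s : ℝ ↦ s • x) (nhds 1) (nhds ((1 : ℝ) • x)) :=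
        (continuous_id.smul continuous_const).tendsto 1
      rw [one_smul] at this
      exact this.mono_left nhdsWithin_le_nhds
    · filter_upwards [hev] with s hs using hspec s ⟨hs.1.le, hs.2⟩
    · exact Filter.Eventually.of_forall fun s ↦ .smul (.all s) hx.isSelfAdjoint
    · simpa using hspec 1 ⟨le_rfl, one_le_two⟩
  exact ge_of_tendsto hlim (by filter_upwards [hev] with s hs using hle s hs.1)

/-- Hansen's inequality for a positive invertible contraction. -/
lemma conj_cfc_le (hh : IsOperatorMonotone.{u} h) (hpos : ∀ t : ℝ, 0 < t → 0 < h t)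
    {a x : H →L[ℂ] H} (ha : IsStrictlyPositive a) (ha1 : a ≤ 1) (hx : IsStrictlyPositive x) :
    a ^ (1 / 2 : ℝ) * cfc h x * a ^ (1 / 2 : ℝ) ≤
      cfc h (a ^ (1 / 2 : ℝ) * x * a ^ (1 / 2 : ℝ)) := by
  have hle1 : ∀ t ∈ spectrum ℝ a, t ≤ 1 := (CFC.le_one_iff a ha.isSelfAdjoint).1 ha1
  have hpa : ∀ t ∈ spectrum ℝ a, 0 < t := fun t ht ↦ ha.spectrum_pos ht
  have haeq : a ^ (1 / 2 : ℝ) = cfc Real.sqrt a := by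
    rw [CFC.rpow_eq_cfc_real ha.nonneg]
    exact cfc_congr fun t _ ↦ (Real.sqrt_eq_rpow t).symm
  -- The complement of a^{1/2}: it commutes with a^{1/2}, and the two squares add up to 1.
  set b : H →L[ℂ] H := cfc (fun t : ℝ ↦ √(1 - t)) a with hb
  have hrsa : IsSelfAdjoint (a ^ (1 / 2 : ℝ)) := IsSelfAdjoint.of_nonneg CFC.rpow_nonneg
  have hbsa : IsSelfAdjoint b := cfc_predicate _ _
  have hcomm : Commute (a ^ (1 / 2 : ℝ)) b := haeq ▸ cfc_commute_cfc _ _ a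
  have hbb : b * b = 1 - a := by
    rw [hb, ← cfc_mul _ _ a]
    conv_rhs => rw [← cfc_id ℝ a, ← cfc_one ℝ a, ← cfc_sub _ _ a]
    exact cfc_congr fun t ht ↦ Real.mul_self_sqrt (sub_nonneg.2 (hle1 t ht))
  have hrr : a ^ (1 / 2 : ℝ) * a ^ (1 / 2 : ℝ) = a := by
    rw [← CFC.rpow_add ha.isUnit]
    norm_num
    exact CFC.rpow_one a ha.nonneg
  have hsum : a ^ (1 / 2 : ℝ) * a ^ (1 / 2 : ℝ) + b * b = 1 := by rw [hrr, hbb]; abel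
  have hX : IsStrictlyPositive (a ^ (1 / 2 : ℝ) * x * a ^ (1 / 2 : ℝ)) :=
    IsStrictlyPositive.conjugate_of_isUnit_of_isSelfAdjoint _ _ (ha.rpow a _).isUnit hrsa hx
  refine hh.le_cfc_of_forall_smul hX fun s hs ↦ ?_
  obtain ⟨m, hm, hmX⟩ := hX.exists_algebraMap_le
  -- One factor 1 + r² pays for approximate concavity, the other for the auxiliary term b y b.
  obtain ⟨r, hr, hrs⟩ : ∃ r : ℝ, 0 < r ∧ (1 + r ^ 2) * (1 + r ^ 2) = s := by
    have h1 : 1 < √s := Real.lt_sqrt_of_sq_lt (by simpa using hs)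
    refine ⟨√(√s - 1), Real.sqrt_pos.2 (sub_pos.2 h1), ?_⟩
    rw [Real.sq_sqrt (sub_pos.2 h1).le, add_sub_cancel, Real.mul_self_sqrt (by linarith)]
  -- Hansen's inequality would take y = 0, where h is not controlled. The scalar y = r² m is
  -- positive, yet small enough that b y b ≤ r² a^{1/2} x a^{1/2}.
  have hε : 0 < r ^ 2 * m := by positivity
  have hy : IsStrictlyPositive (algebraMap ℝ (H →L[ℂ] H) (r ^ 2 * m)) :=
    isStrictlyPositive_algebraMap hε
  have hby : b * algebraMap ℝ (H →L[ℂ] H) (r ^ 2 * m) * b ≤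
      r ^ 2 • (a ^ (1 / 2 : ℝ) * x * a ^ (1 / 2 : ℝ)) := by
    calc b * algebraMap ℝ (H →L[ℂ] H) (r ^ 2 * m) * b = (r ^ 2 * m) • (1 - a) := by
          simp [Algebra.algebraMap_eq_smul_one, hbb]
      _ ≤ (r ^ 2 * m) • (1 : H →L[ℂ] H) :=
          smul_le_smul_of_nonneg_left (sub_le_self _ ha.nonneg) hε.le
      _ = r ^ 2 • algebraMap ℝ (H →L[ℂ] H) m := by
          simp [Algebra.algebraMap_eq_smul_one, smul_smul]
      _ ≤ _ := smul_le_smul_of_nonneg_left hmX (sq_nonneg r)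
  have hpos_y : 0 ≤ b * cfc h (algebraMap ℝ (H →L[ℂ] H) (r ^ 2 * m)) * b :=
    hbsa.conjugate_nonneg (cfc_nonneg fun t ht ↦ (hpos t (hy.spectrum_pos ht)).le)
  calc a ^ (1 / 2 : ℝ) * cfc h x * a ^ (1 / 2 : ℝ)
      ≤ a ^ (1 / 2 : ℝ) * cfc h x * a ^ (1 / 2 : ℝ) +
        b * cfc h (algebraMap ℝ (H →L[ℂ] H) (r ^ 2 * m)) * b := le_add_of_nonneg_right hpos_y
    _ ≤ cfc h ((1 + r ^ 2) • (a ^ (1 / 2 : ℝ) * x * a ^ (1 / 2 : ℝ) +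
          b * algebraMap ℝ (H →L[ℂ] H) (r ^ 2 * m) * b)) :=
        hh.conj_cfc_add_le hrsa hbsa hcomm hsum hx hy hr
    _ ≤ cfc h (s • (a ^ (1 / 2 : ℝ) * x * a ^ (1 / 2 : ℝ))) := by
        refine hh.mono H _ _ (.smul (by positivity) (hx.conj_add_conj hy hrsa hbsa hsum)) ?_
        rw [← hrs, mul_smul, add_smul 1 (r ^ 2) (_ * x * _), one_smul]
        exact smul_le_smul_of_nonneg_left (add_le_add_right hby _) (by positivity)

end IsOperatorMonotone
end

/-! ### Operator means: congruence invariance and monotonicity -/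

section

variable {H : Type u} [NormedAddCommGroup H] [InnerProductSpace ℂ H] [CompleteSpace H]

namespace IsStrictlyPositive

variable {a b : H →L[ℂ] H}

lemma isSelfAdjoint_rpow (a : H →L[ℂ] H) (r : ℝ) : IsSelfAdjoint (a ^ r) :=
  IsSelfAdjoint.of_nonneg CFC.rpow_nonneg

lemma rpow_half_mul_self (ha : IsStrictlyPositive a) :
    a ^ (1 / 2 : ℝ) * a ^ (1 / 2 : ℝ) = a := by
  rw [← CFC.rpow_add ha.isUnit, add_halves, CFC.rpow_one a ha.nonneg]

lemma conj_rpow (ha : IsStrictlyPositive a) (hb : IsStrictlyPositive b) (r : ℝ) :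
    IsStrictlyPositive (a ^ r * b * a ^ r) :=
  conjugate_of_isUnit_of_isSelfAdjoint _ _ (ha.rpow a r).isUnit (isSelfAdjoint_rpow a r) hb

lemma conj_rpow_neg_conj_rpow (ha : IsStrictlyPositive a) (r : ℝ) (b : H →L[ℂ] H) :
    a ^ r * (a ^ (-r) * b * a ^ (-r)) * a ^ r = b := by
  calc a ^ r * (a ^ (-r) * b * a ^ (-r)) * a ^ r
      = (a ^ r * a ^ (-r)) * b * (a ^ (-r) * a ^ r) := by noncomm_ring
    _ = b := by rw [CFC.rpow_mul_rpow_neg r ha, CFC.rpow_neg_mul_rpow r ha, one_mul, mul_one]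

lemma conj_rpow_conj_rpow_neg (ha : IsStrictlyPositive a) (r : ℝ) (b : H →L[ℂ] H) :
    a ^ (-r) * (a ^ r * b * a ^ r) * a ^ (-r) = b := by
  simpa using ha.conj_rpow_neg_conj_rpow (-r) b

lemma conj_rpow_neg_half_self (ha : IsStrictlyPositive a) :
    a ^ (-(1 / 2) : ℝ) * a * a ^ (-(1 / 2) : ℝ) = 1 := by
  have := ha.conj_rpow_conj_rpow_neg (1 / 2) 1
  rwa [mul_one, ha.rpow_half_mul_self] at this

/-- Powers with exponent in `[-1, 0]` are operator antitone. -/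
lemma rpow_le_rpow_of_nonpos (ha : IsStrictlyPositive a) (hab : a ≤ b) {q : ℝ} (hq : -1 ≤ q)
    (hq' : q ≤ 0) : b ^ q ≤ a ^ q := by
  obtain rfl | hq0 := hq'.eq_or_lt
  · rw [CFC.rpow_zero a ha.nonneg, CFC.rpow_zero b (ha.of_le hab).nonneg]
  have hb := ha.of_le hab
  have h1 := CFC.rpow_le_rpow (p := -q) ⟨by linarith, by linarith⟩ hab
  have h2 := CStarAlgebra.rpow_neg_one_le_rpow_neg_one h1 (ha.rpow a _)
  rwa [CFC.rpow_rpow a _ _ (by linarith) ha, CFC.rpow_rpow b _ _ (by linarith) hb,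
    neg_mul_neg, mul_one] at h2

end IsStrictlyPositive

/-- `(T T†)^(q + 1) = T (T† T)^q T†` for invertible `T`. -/
lemma IsUnit.mul_star_self_rpow {T : H →L[ℂ] H} (hT : IsUnit T) (q : ℝ) :
    (T * star T) ^ (q + 1) = T * (star T * T) ^ q * star T := by
  have h1 : IsStrictlyPositive (T * star T) :=
    (hT.mul hT.star).isStrictlyPositive (mul_star_self_nonneg T)
  have h2 : IsStrictlyPositive (star T * T) :=
    (hT.star.mul hT).isStrictlyPositive (star_mul_self_nonneg T)
  have hcont : ContinuousOn (fun x : ℝ ↦ x ^ q)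
      (spectrum ℝ (T * star T) ∪ spectrum ℝ (star T * T)) := by
    refine continuousOn_id.rpow_const fun t ht ↦ Or.inl ?_
    exact (Set.union_subset h1.spectrum_subset_Ioi h2.spectrum_subset_Ioi ht).ne'
  have h3 := cfc_mul_eq_mul_cfc_of_intertwine (fun x : ℝ ↦ x ^ q) h1.isSelfAdjoint
    h2.isSelfAdjoint hcont (mul_assoc T (star T) T)
  rw [← CFC.rpow_eq_cfc_real h1.nonneg, ← CFC.rpow_eq_cfc_real h2.nonneg] at h3
  rw [CFC.rpow_add h1.isUnit, CFC.rpow_one _ h1.nonneg, ← h3, mul_assoc]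

lemma IsUnit.spectrum_mul_star_self {T : H →L[ℂ] H} (hT : IsUnit T) :
    spectrum ℝ (T * star T) = spectrum ℝ (star T * T) := by
  lift T to (H →L[ℂ] H)ˣ using hT
  rw [← spectrum.units_conjugate (u := T) (a := star (T : H →L[ℂ] H) * T)]
  congr 1
  simp [mul_assoc]

lemma operatorMean_def (h : ℝ → ℝ) (A B : H →L[ℂ] H) : operatorMean h A B =
    A ^ (1 / 2 : ℝ) * cfc h (A ^ (-(1 / 2) : ℝ) * B * A ^ (-(1 / 2) : ℝ)) * A ^ (1 / 2 : ℝ) := rfl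

/-- Invariance of operator means under invertible congruences. -/
lemma operatorMean_conj {h : ℝ → ℝ} (hh : ContinuousOn h (Set.Ioi 0)) {A B T : H →L[ℂ] H}
    (hA : IsStrictlyPositive A) (hB : IsStrictlyPositive B) (hT : IsUnit T) :
    operatorMean h (T * A * star T) (T * B * star T) = T * operatorMean h A B * star T := by
  have hD : IsStrictlyPositive (T * A * star T) :=
    hT.isStrictlyPositive_star_right_conjugate_iff.2 hA
  have hE : IsStrictlyPositive (T * B * star T) :=
    hT.isStrictlyPositive_star_right_conjugate_iff.2 hB
  have hX := hD.conj_rpow hE (-(1 / 2))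
  have hY := hA.conj_rpow hB (-(1 / 2))
  rw [operatorMean_def, operatorMean_def]
  have hdd := hD.rpow_half_mul_self
  have hdd' := CFC.rpow_mul_rpow_neg (1 / 2) hD
  have hd'd := CFC.rpow_neg_mul_rpow (1 / 2) hD
  have haa := hA.rpow_half_mul_self
  have haa' := CFC.rpow_mul_rpow_neg (1 / 2) hA
  have ha'a := CFC.rpow_neg_mul_rpow (1 / 2) hA
  set D := T * A * star T with hDdef
  set d := D ^ (1 / 2 : ℝ)
  set d' := D ^ (-(1 / 2) : ℝ)
  set a := A ^ (1 / 2 : ℝ)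
  set a' := A ^ (-(1 / 2) : ℝ)
  -- This is A⁻¹ = T† D⁻¹ T. It makes S = d' T a intertwine the two arguments of h, so S can be
  -- moved through the functional calculus.
  have hinv : A * (star T * (d' * d') * T) = 1 := by
    have h1 : T * A * star T * (d' * d') = 1 := by
      rw [← hDdef, ← hdd, mul_assoc, ← mul_assoc d d', hdd', one_mul, hdd']
    refine hT.mul_left_cancel ?_
    calc T * (A * (star T * (d' * d') * T)) = T * A * star T * (d' * d') * T := by noncomm_ring
      _ = T * 1 := by rw [h1, one_mul, mul_one]
  have hQ : star T * (d' * d') * T * a = a' := by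
    calc star T * (d' * d') * T * a
        = a' * (a' * a) * a * (star T * (d' * d') * T * a) := by
          rw [ha'a, mul_one, ha'a, one_mul]
      _ = a' * a' * (a * a * (star T * (d' * d') * T)) * a := by noncomm_ring
      _ = a' := by rw [haa, hinv, mul_one, mul_assoc, ha'a, mul_one]
  have hint : d' * (T * B * star T) * d' * (d' * T * a) = d' * T * a * (a' * B * a') := by
    calc d' * (T * B * star T) * d' * (d' * T * a)
        = d' * T * B * (star T * (d' * d') * T * a) := by noncomm_ring
      _ = d' * T * (a * a') * B * a' := by rw [hQ, haa', mul_one]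
      _ = d' * T * a * (a' * B * a') := by noncomm_ring
  have hS := cfc_mul_eq_mul_cfc_of_intertwine h hX.isSelfAdjoint hY.isSelfAdjoint
    (hh.mono (Set.union_subset hX.spectrum_subset_Ioi hY.spectrum_subset_Ioi)) hint
  have hd : d' * T * a * a * star T = d := by
    calc d' * T * a * a * star T = d' * (T * (a * a) * star T) := by noncomm_ring
      _ = d := by rw [haa, ← hDdef, ← hdd, ← mul_assoc, hd'd, one_mul]
  calc d * cfc h (d' * (T * B * star T) * d') * d
      = d * cfc h (d' * (T * B * star T) * d') * (d' * T * a * a * star T) := by rw [hd]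
    _ = d * (cfc h (d' * (T * B * star T) * d') * (d' * T * a)) * a * star T := by noncomm_ring
    _ = (d * d') * T * a * cfc h (a' * B * a') * a * star T := by rw [hS]; noncomm_ring
    _ = T * (a * cfc h (a' * B * a') * a) * star T := by rw [hdd']; noncomm_ring

lemma operatorMean_conj_rpow {h : ℝ → ℝ} (hh : ContinuousOn h (Set.Ioi 0)) {A B R : H →L[ℂ] H}
    (hA : IsStrictlyPositive A) (hB : IsStrictlyPositive B) (hR : IsStrictlyPositive R) (r : ℝ) :
    operatorMean h (R ^ r * A * R ^ r) (R ^ r * B * R ^ r) =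
      R ^ r * operatorMean h A B * R ^ r := by
  have := operatorMean_conj hh hA hB (hR.rpow R r).isUnit
  rwa [(IsStrictlyPositive.isSelfAdjoint_rpow R r).star_eq] at this

namespace IsOperatorMonotone

variable {h : ℝ → ℝ} {A A' B B' : H →L[ℂ] H}

lemma operatorMean_mono_right (hh : IsOperatorMonotone.{u} h) (hA : IsStrictlyPositive A)
    (hB : IsStrictlyPositive B) (hBB : B ≤ B') : operatorMean h A B ≤ operatorMean h A B' :=
  (IsStrictlyPositive.isSelfAdjoint_rpow A _).conjugate_le_conjugate <|
    hh.mono H _ _ (hA.conj_rpow hB _) <|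
      (IsStrictlyPositive.isSelfAdjoint_rpow A _).conjugate_le_conjugate hBB

/-- Congruence by A'^{-1/2} reduces to A' = 1, where A is a contraction. Hansen's inequality with x
= A^{-1/2} B A^{-1/2} then reads A σ B ≤ h(B) = 1 σ B. -/
lemma operatorMean_mono_left (hh : IsOperatorMonotone.{u} h) (hpos : ∀ t : ℝ, 0 < t → 0 < h t)
    (hA : IsStrictlyPositive A) (hB : IsStrictlyPositive B) (hAA : A ≤ A') :
    operatorMean h A B ≤ operatorMean h A' B := by
  have hA' := hA.of_le hAA
  have hA0 := hA'.conj_rpow hA (-(1 / 2))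
  have hB0 := hA'.conj_rpow hB (-(1 / 2))
  have hle : A' ^ (-(1 / 2) : ℝ) * A * A' ^ (-(1 / 2) : ℝ) ≤ 1 := by
    rw [← hA'.conj_rpow_neg_half_self]
    exact (IsStrictlyPositive.isSelfAdjoint_rpow A' _).conjugate_le_conjugate hAA
  have h1 := hh.conj_cfc_le hpos hA0 hle (hA0.conj_rpow hB0 (-(1 / 2)))
  rw [hA0.conj_rpow_neg_conj_rpow, ← operatorMean_def] at h1
  have h2 := operatorMean_conj_rpow hh.continuousOn hA0 hB0 hA' (1 / 2)
  rw [hA'.conj_rpow_neg_conj_rpow, hA'.conj_rpow_neg_conj_rpow] at h2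
  rw [h2]
  exact (IsStrictlyPositive.isSelfAdjoint_rpow A' _).conjugate_le_conjugate h1

lemma operatorMean_mono (hh : IsOperatorMonotone.{u} h) (hpos : ∀ t : ℝ, 0 < t → 0 < h t)
    (hA : IsStrictlyPositive A) (hB : IsStrictlyPositive B) (hAA : A ≤ A') (hBB : B ≤ B') :
    operatorMean h A B ≤ operatorMean h A' B' :=
  (hh.operatorMean_mono_left hpos hA hB hAA).trans
    (hh.operatorMean_mono_right (hA.of_le hAA) hB hBB)

end IsOperatorMonotone

lemma cfc_mul_mul {f g : ℝ → ℝ} {C : H →L[ℂ] H} (hf : ContinuousOn f (spectrum ℝ C))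
    (hg : ContinuousOn g (spectrum ℝ C)) :
    cfc f C * cfc g C * cfc f C = cfc (fun t ↦ f t * g t * f t) C := by
  rw [← cfc_mul f g C hf hg, ← cfc_mul (fun t ↦ f t * g t) f C (hf.mul hg) hf]

/-- The mean of two commuting operators, given as functions of a third one. -/
lemma operatorMean_cfc {h u v : ℝ → ℝ} {C : H →L[ℂ] H} (hh : ContinuousOn h (Set.Ioi 0))
    (hC : IsSelfAdjoint C) (hu : ContinuousOn u (spectrum ℝ C))
    (hv : ContinuousOn v (spectrum ℝ C)) (hu0 : ∀ t ∈ spectrum ℝ C, 0 < u t)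
    (hv0 : ∀ t ∈ spectrum ℝ C, 0 < v t) :
    operatorMean h (cfc u C) (cfc (fun t ↦ u t * v t) C) = cfc (fun t ↦ u t * h (v t)) C := by
  have hur (r : ℝ) : ContinuousOn (fun t ↦ u t ^ r) (spectrum ℝ C) :=
    hu.rpow_const fun t ht ↦ Or.inl (hu0 t ht).ne'
  have hhv : ContinuousOn (fun t ↦ h (v t)) (spectrum ℝ C) := hh.comp hv hv0
  have huv : ContinuousOn (fun t ↦ u t * v t) (spectrum ℝ C) := hu.mul hv
  rw [operatorMean_def, CFC.cfc_rpow hu0 hu hC, CFC.cfc_rpow hu0 hu hC,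
    cfc_mul_mul (hur _) huv]
  have h1 : cfc (fun t ↦ u t ^ (-(1 / 2) : ℝ) * (u t * v t) * u t ^ (-(1 / 2) : ℝ)) C =
      cfc v C := by
    refine cfc_congr fun t ht ↦ ?_
    have := hu0 t ht
    have h2 : u t ^ (-(1 / 2) : ℝ) * u t ^ (-(1 / 2) : ℝ) * u t = 1 := by
      rw [← Real.rpow_add this, ← Real.rpow_add_one this.ne']
      norm_num
    calc _ = u t ^ (-(1 / 2) : ℝ) * u t ^ (-(1 / 2) : ℝ) * u t * v t := by ring
      _ = v t := by rw [h2, one_mul]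
  rw [h1, ← cfc_comp' h v C (hh.mono (by rintro _ ⟨t, ht, rfl⟩; exact hv0 t ht)) hv hC,
    cfc_mul_mul (hur _) hhv]
  refine cfc_congr fun t ht ↦ ?_
  have h2 : u t ^ (1 / 2 : ℝ) * u t ^ (1 / 2 : ℝ) = u t := by
    rw [← Real.rpow_add (hu0 t ht)]
    norm_num
  calc _ = u t ^ (1 / 2 : ℝ) * u t ^ (1 / 2 : ℝ) * h (v t) := by ring
    _ = _ := by rw [h2]

end

/-! ### The quotient, the reduced mean and bounds on A -/

section

variable {H : Type u} [NormedAddCommGroup H] [InnerProductSpace ℂ H] [CompleteSpace H]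

lemma lambdaMin_le_of_mem_spectrum {X : H →L[ℂ] H} {t : ℝ} (ht : t ∈ spectrum ℝ X) :
    lambdaMin X ≤ t :=
  csInf_le (spectrum.isCompact X).bddBelow ht

lemma IsStrictlyPositive.lambdaMin_pos [Nontrivial H] {X : H →L[ℂ] H}
    (hX : IsStrictlyPositive X) : 0 < lambdaMin X :=
  hX.spectrum_pos ((spectrum.isCompact X).sInf_mem
    (ContinuousFunctionalCalculus.spectrum_nonempty X hX.isSelfAdjoint))

lemma IsSelfAdjoint.algebraMap_lambdaMin_le {X : H →L[ℂ] H} (hX : IsSelfAdjoint X) :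
    algebraMap ℝ (H →L[ℂ] H) (lambdaMin X) ≤ X :=
  (algebraMap_le_iff_le_spectrum hX).2 fun _ ht ↦ lambdaMin_le_of_mem_spectrum ht

section

variable {h : ℝ → ℝ} {A C : H →L[ℂ] H}

lemma powerQuotient_eq_cfc (hh : ContinuousOn h (Set.Ioi 0)) (hpos : ∀ t : ℝ, 0 < t → 0 < h t)
    (hC : IsStrictlyPositive C) (p : ℝ) :
    powerQuotient h p C = cfc (fun t ↦ h (t ^ p) * h t ^ (-p)) C := by
  have hp : ContinuousOn (fun t : ℝ ↦ t ^ p) (spectrum ℝ C) :=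
    continuousOn_id.rpow_const fun t ht ↦ Or.inl (hC.spectrum_pos ht).ne'
  have hp0 : ∀ t ∈ spectrum ℝ C, 0 < t ^ p := fun t ht ↦
    Real.rpow_pos_of_pos (hC.spectrum_pos ht) p
  have hhC := hh.mono hC.spectrum_subset_Ioi
  rw [powerQuotient, CFC.rpow_eq_cfc_real hC.nonneg,
    CFC.cfc_rpow (fun t ht ↦ hpos t (hC.spectrum_pos ht)) hhC hC.isSelfAdjoint,
    ← cfc_comp' h _ C (hh.mono (by rintro _ ⟨t, ht, rfl⟩; exact hp0 t ht)) hp hC.isSelfAdjoint,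
    ← cfc_mul (fun t ↦ h (t ^ p)) _ C (hh.comp hp hp0)
      (hhC.rpow_const fun t ht ↦ Or.inl (hpos t (hC.spectrum_pos ht)).ne')]

lemma continuousOn_quotient (hh : ContinuousOn h (Set.Ioi 0)) (hpos : ∀ t : ℝ, 0 < t → 0 < h t)
    (p : ℝ) : ContinuousOn (fun t ↦ h (t ^ p) * h t ^ (-p)) (Set.Ioi 0) := by
  refine ContinuousOn.mul (hh.comp (continuousOn_id.rpow_const fun t ht ↦ Or.inl (ne_of_gt ht))
    fun t ht ↦ Real.rpow_pos_of_pos ht p) ?_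
  exact hh.rpow_const fun t ht ↦ Or.inl (hpos t ht).ne'

lemma lambdaMin_powerQuotient_le (hh : ContinuousOn h (Set.Ioi 0))
    (hpos : ∀ t : ℝ, 0 < t → 0 < h t) (hC : IsStrictlyPositive C) (p : ℝ) {t : ℝ}
    (ht : t ∈ spectrum ℝ C) : lambdaMin (powerQuotient h p C) ≤ h (t ^ p) * h t ^ (-p) := by
  refine lambdaMin_le_of_mem_spectrum ?_
  rw [powerQuotient_eq_cfc hh hpos hC, cfc_map_spectrum _ C hC.isSelfAdjoint
    ((continuousOn_quotient hh hpos p).mono hC.spectrum_subset_Ioi)]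
  exact ⟨t, ht, rfl⟩

lemma le_norm_powerQuotient (hh : ContinuousOn h (Set.Ioi 0))
    (hpos : ∀ t : ℝ, 0 < t → 0 < h t) (hC : IsStrictlyPositive C) (p : ℝ) {t : ℝ}
    (ht : t ∈ spectrum ℝ C) : h (t ^ p) * h t ^ (-p) ≤ ‖powerQuotient h p C‖ := by
  have hc := (continuousOn_quotient hh hpos p).mono hC.spectrum_subset_Ioi
  rw [powerQuotient_eq_cfc hh hpos hC]
  exact (cfc_le_algebraMap_iff _ _ C hc hC.isSelfAdjoint).1
    (IsSelfAdjoint.le_algebraMap_norm_self (cfc_predicate _ C)) t ht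

/-- The mean of `X ^ q` and `C^{1/2} (C^{1/2} X C^{1/2}) ^ q C^{1/2}`. -/
noncomputable def reducedMean (h : ℝ → ℝ) (q : ℝ) (C X : H →L[ℂ] H) : H →L[ℂ] H :=
  operatorMean h (X ^ q) (C ^ (1 / 2 : ℝ) *
    (C ^ (1 / 2 : ℝ) * X * C ^ (1 / 2 : ℝ)) ^ q * C ^ (1 / 2 : ℝ))

/-- The power identity reducing `A^p σ B^p` to a mean of `(p - 1)`-th powers. -/
lemma operatorMean_rpow (hh : ContinuousOn h (Set.Ioi 0)) (hA : IsStrictlyPositive A)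
    (hC : IsStrictlyPositive C) (q : ℝ) :
    operatorMean h (A ^ (q + 1)) ((A ^ (1 / 2 : ℝ) * C * A ^ (1 / 2 : ℝ)) ^ (q + 1)) =
      A ^ (1 / 2 : ℝ) * reducedMean h q C A * A ^ (1 / 2 : ℝ) := by
  have hT : IsUnit (A ^ (1 / 2 : ℝ) * C ^ (1 / 2 : ℝ)) :=
    (hA.rpow A _).isUnit.mul (hC.rpow C _).isUnit
  have hsT : star (A ^ (1 / 2 : ℝ) * C ^ (1 / 2 : ℝ)) = C ^ (1 / 2 : ℝ) * A ^ (1 / 2 : ℝ) := by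
    rw [star_mul, (IsStrictlyPositive.isSelfAdjoint_rpow A _).star_eq,
      (IsStrictlyPositive.isSelfAdjoint_rpow C _).star_eq]
  have h1 := hT.mul_star_self_rpow q
  rw [hsT] at h1
  have h2 : A ^ (1 / 2 : ℝ) * C ^ (1 / 2 : ℝ) * (C ^ (1 / 2 : ℝ) * A ^ (1 / 2 : ℝ)) =
      A ^ (1 / 2 : ℝ) * C * A ^ (1 / 2 : ℝ) := by
    conv_rhs => rw [← hC.rpow_half_mul_self]
    noncomm_ring
  have h3 : C ^ (1 / 2 : ℝ) * A ^ (1 / 2 : ℝ) * (A ^ (1 / 2 : ℝ) * C ^ (1 / 2 : ℝ)) =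
      C ^ (1 / 2 : ℝ) * A * C ^ (1 / 2 : ℝ) := by
    conv_rhs => rw [← hA.rpow_half_mul_self]
    noncomm_ring
  have h4 : A ^ (q + 1) = A ^ (1 / 2 : ℝ) * A ^ q * A ^ (1 / 2 : ℝ) := by
    rw [← CFC.rpow_add hA.isUnit, ← CFC.rpow_add hA.isUnit]
    ring_nf
  rw [h2, h3] at h1
  rw [reducedMean, ← operatorMean_conj_rpow hh (hA.rpow A q)
    (hC.conj_rpow ((hC.conj_rpow hA _).rpow _ q) _) hA, h1, h4]
  congr 1

/-- The reduced mean of a function of `C`. -/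
lemma reducedMean_cfc {g : ℝ → ℝ} (hh : ContinuousOn h (Set.Ioi 0))
    (hC : IsStrictlyPositive C) (hg : ContinuousOn g (spectrum ℝ C))
    (hg0 : ∀ t ∈ spectrum ℝ C, 0 < g t) (q : ℝ) :
    reducedMean h q C (cfc g C) =
      cfc (fun t ↦ g t ^ q * h (t ^ (q + 1))) C := by
  have hr (r : ℝ) : ContinuousOn (fun t : ℝ ↦ t ^ r) (spectrum ℝ C) :=
    continuousOn_id.rpow_const fun t ht ↦ Or.inl (hC.spectrum_pos ht).ne'
  have hgq : ContinuousOn (fun t : ℝ ↦ g t ^ q) (spectrum ℝ C) :=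
    hg.rpow_const fun t ht ↦ Or.inl (hg0 t ht).ne'
  have hhalf {t : ℝ} (ht : t ∈ spectrum ℝ C) : t ^ (1 / 2 : ℝ) * t ^ (1 / 2 : ℝ) = t := by
    rw [← Real.rpow_add (hC.spectrum_pos ht)]
    norm_num
  have h1 : C ^ (1 / 2 : ℝ) * cfc g C * C ^ (1 / 2 : ℝ) = cfc (fun t ↦ t * g t) C := by
    rw [CFC.rpow_eq_cfc_real hC.nonneg, cfc_mul_mul (hr _) hg]
    refine cfc_congr fun t ht ↦ ?_
    calc _ = t ^ (1 / 2 : ℝ) * t ^ (1 / 2 : ℝ) * g t := by ring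
      _ = _ := by rw [hhalf ht]
  have htg : ∀ t ∈ spectrum ℝ C, 0 < t * g t := fun t ht ↦
    mul_pos (hC.spectrum_pos ht) (hg0 t ht)
  have htgc : ContinuousOn (fun t ↦ t * g t) (spectrum ℝ C) := continuousOn_id.mul hg
  have htgq : ContinuousOn (fun t ↦ (t * g t) ^ q) (spectrum ℝ C) :=
    htgc.rpow_const fun t ht ↦ Or.inl (htg t ht).ne'
  rw [reducedMean, h1, CFC.cfc_rpow htg htgc hC.isSelfAdjoint, CFC.cfc_rpow hg0 hg hC.isSelfAdjoint,
    CFC.rpow_eq_cfc_real hC.nonneg, cfc_mul_mul (hr _) htgq,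
    ← operatorMean_cfc hh hC.isSelfAdjoint hgq (hr (q + 1))
      (fun t ht ↦ Real.rpow_pos_of_pos (hg0 t ht) q)
      (fun t ht ↦ Real.rpow_pos_of_pos (hC.spectrum_pos ht) _)]
  congr 1
  refine cfc_congr fun t ht ↦ ?_
  have ht0 := hC.spectrum_pos ht
  calc t ^ (1 / 2 : ℝ) * (t * g t) ^ q * t ^ (1 / 2 : ℝ)
      = t ^ (1 / 2 : ℝ) * t ^ (1 / 2 : ℝ) * (t ^ q * g t ^ q) := by
        rw [Real.mul_rpow ht0.le (hg0 t ht).le]; ring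
    _ = g t ^ q * t ^ (q + 1) := by rw [hhalf ht, Real.rpow_add_one ht0.ne']; ring

end

namespace IsOperatorMonotone

variable {h : ℝ → ℝ} {A A' C : H →L[ℂ] H}

/-- The reduced mean is monotone for exponents in `[0, 1]`. -/
lemma reducedMean_mono (hh : IsOperatorMonotone.{u} h) (hpos : ∀ t : ℝ, 0 < t → 0 < h t)
    (hA : IsStrictlyPositive A) (hC : IsStrictlyPositive C) (hAA : A ≤ A') {q : ℝ} (hq : 0 ≤ q)
    (hq1 : q ≤ 1) :
    reducedMean h q C A ≤
      reducedMean h q C A' := by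
  have hs := IsStrictlyPositive.isSelfAdjoint_rpow C (1 / 2)
  exact hh.operatorMean_mono hpos (hA.rpow A q)
    (hC.conj_rpow ((hC.conj_rpow hA _).rpow _ q) _) (CFC.rpow_le_rpow ⟨hq, hq1⟩ hAA)
    (hs.conjugate_le_conjugate
      (CFC.rpow_le_rpow ⟨hq, hq1⟩ (hs.conjugate_le_conjugate hAA)))

/-- The reduced mean is antitone for exponents in `[-1, 0]`. -/
lemma reducedMean_anti (hh : IsOperatorMonotone.{u} h) (hpos : ∀ t : ℝ, 0 < t → 0 < h t)
    (hA : IsStrictlyPositive A) (hC : IsStrictlyPositive C) (hAA : A ≤ A') {q : ℝ}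
    (hq1 : -1 ≤ q) (hq : q ≤ 0) :
    reducedMean h q C A' ≤
      reducedMean h q C A := by
  have hs := IsStrictlyPositive.isSelfAdjoint_rpow C (1 / 2)
  have hA' := hA.of_le hAA
  exact hh.operatorMean_mono hpos (hA'.rpow A' q)
    (hC.conj_rpow ((hC.conj_rpow hA' _).rpow _ q) _) (hA.rpow_le_rpow_of_nonpos hAA hq1 hq)
    (hs.conjugate_le_conjugate ((hC.conj_rpow hA _).rpow_le_rpow_of_nonpos
      (hs.conjugate_le_conjugate hAA) hq1 hq))

end IsOperatorMonotone

namespace IsStrictlyPositive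

variable {a b : H →L[ℂ] H} {r : ℝ}

/-- With T = a^{1/2} b^{1/2} these are T T† and T† T, which are similar. This lets a scalar bound on
a^{1/2} b a^{1/2} pass to b^{1/2} a b^{1/2}, where a can be isolated. -/
lemma spectrum_conj_rpow_half (ha : IsStrictlyPositive a) (hb : IsStrictlyPositive b) :
    spectrum ℝ (a ^ (1 / 2 : ℝ) * b * a ^ (1 / 2 : ℝ)) =
      spectrum ℝ (b ^ (1 / 2 : ℝ) * a * b ^ (1 / 2 : ℝ)) := by
  have := ((ha.rpow a (1 / 2)).isUnit.mul (hb.rpow b (1 / 2)).isUnit).spectrum_mul_star_self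
  rw [star_mul, (isSelfAdjoint_rpow a _).star_eq, (isSelfAdjoint_rpow b _).star_eq] at this
  convert this using 2
  · conv_lhs => rw [← hb.rpow_half_mul_self]
    noncomm_ring
  · conv_lhs => rw [← ha.rpow_half_mul_self]
    noncomm_ring

lemma conj_algebraMap_rpow_neg_half (hb : IsStrictlyPositive b) (r : ℝ) :
    b ^ (-(1 / 2) : ℝ) * algebraMap ℝ (H →L[ℂ] H) r * b ^ (-(1 / 2) : ℝ) =
      r • b ^ (-1 : ℝ) := by
  simp only [Algebra.algebraMap_eq_smul_one, mul_smul_comm, mul_one, smul_mul_assoc]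
  rw [← CFC.rpow_add hb.isUnit]
  norm_num

lemma le_smul_rpow_neg_one (ha : IsStrictlyPositive a) (hb : IsStrictlyPositive b)
    (hle : a ^ (1 / 2 : ℝ) * b * a ^ (1 / 2 : ℝ) ≤ algebraMap ℝ _ r) :
    a ≤ r • b ^ (-1 : ℝ) := by
  rw [le_algebraMap_iff_spectrum_le (ha.conj_rpow hb _).isSelfAdjoint,
    ha.spectrum_conj_rpow_half hb,
    ← le_algebraMap_iff_spectrum_le (hb.conj_rpow ha _).isSelfAdjoint] at hle
  have := (isSelfAdjoint_rpow b (-(1 / 2))).conjugate_le_conjugate hle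
  rwa [hb.conj_rpow_conj_rpow_neg, hb.conj_algebraMap_rpow_neg_half] at this

lemma smul_rpow_neg_one_le (ha : IsStrictlyPositive a) (hb : IsStrictlyPositive b)
    (hle : algebraMap ℝ _ r ≤ a ^ (1 / 2 : ℝ) * b * a ^ (1 / 2 : ℝ)) :
    r • b ^ (-1 : ℝ) ≤ a := by
  rw [algebraMap_le_iff_le_spectrum (ha.conj_rpow hb _).isSelfAdjoint,
    ha.spectrum_conj_rpow_half hb,
    ← algebraMap_le_iff_le_spectrum (hb.conj_rpow ha _).isSelfAdjoint] at hle
  have := (isSelfAdjoint_rpow b (-(1 / 2))).conjugate_le_conjugate hle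
  rwa [hb.conj_rpow_conj_rpow_neg, hb.conj_algebraMap_rpow_neg_half] at this

end IsStrictlyPositive

lemma smul_cfc_rpow_neg_one {h : ℝ → ℝ} {C : H →L[ℂ] H} (hh : ContinuousOn h (Set.Ioi 0))
    (hpos : ∀ t : ℝ, 0 < t → 0 < h t) (hC : IsStrictlyPositive C) (r : ℝ) :
    r • cfc h C ^ (-1 : ℝ) = cfc (fun t ↦ r * (h t)⁻¹) C := by
  have h0 : ∀ t ∈ spectrum ℝ C, 0 < h t := fun t ht ↦ hpos t (hC.spectrum_pos ht)
  have hhC := hh.mono hC.spectrum_subset_Ioi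
  rw [CFC.cfc_rpow h0 hhC hC.isSelfAdjoint,
    ← cfc_smul r _ C (hhC.rpow_const fun t ht ↦ Or.inl (h0 t ht).ne')]
  exact cfc_congr fun t _ ↦ by simp [Real.rpow_neg_one]

/-- Used with a = h(t), b = h(t^p) and q = p - 1: it splits off the quotient h(t^p) h(t)^{-p} and
leaves one factor h(t) to rebuild the mean. -/
lemma mul_inv_rpow_mul {r a b : ℝ} (hr : 0 < r) (ha : 0 < a) (q : ℝ) :
    (r * a⁻¹) ^ q * b = r ^ q * (b * a ^ (-(q + 1))) * a := by
  have h1 : a ^ (-(q + 1)) * a = (a ^ q)⁻¹ := by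
    rw [← Real.rpow_add_one ha.ne', ← Real.rpow_neg ha.le]
    ring_nf
  rw [Real.mul_rpow hr.le (inv_pos.2 ha).le, Real.inv_rpow ha.le, ← h1]
  ring

end

/-! ### The main theorem -/

theorem theorem3p2 {H : Type u} [NormedAddCommGroup H] [InnerProductSpace ℂ H] [CompleteSpace H]
    (h : ℝ → ℝ) (hh : IsOMPlusOne.{u} h)
    (A B : H →L[ℂ] H) (hA : IsStrictlyPositive A) (hB : IsStrictlyPositive B)
    (C : H →L[ℂ] H) (hC : C = A ^ (-(1 / 2) : ℝ) * B * A ^ (-(1 / 2) : ℝ)) :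
    (∀ p : ℝ, 1 ≤ p → p ≤ 2 →
      (lambdaMin (powerQuotient h p C) * lambdaMin (operatorMean h A B) ^ (p - 1)) •
          operatorMean h A B ≤ operatorMean h (A ^ p) (B ^ p) ∧
      operatorMean h (A ^ p) (B ^ p) ≤
        (‖powerQuotient h p C‖ * ‖operatorMean h A B‖ ^ (p - 1)) • operatorMean h A B) ∧
    (∀ p : ℝ, 0 < p → p ≤ 1 →
      operatorMean h (A ^ p) (B ^ p) ≤
          (‖powerQuotient h p C‖ * lambdaMin (operatorMean h A B) ^ (p - 1)) •
            operatorMean h A B ∧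
      (lambdaMin (powerQuotient h p C) * ‖operatorMean h A B‖ ^ (p - 1)) •
          operatorMean h A B ≤ operatorMean h (A ^ p) (B ^ p)) := by
  -- On the zero space spectra are empty, so `lambdaMin` is not positive there; all operators
  -- coincide and the inequalities are trivial.
  obtain hH | hH := subsingleton_or_nontrivial H
  · have hle (X Y : H →L[ℂ] H) : X ≤ Y := (Subsingleton.elim X Y).le
    exact ⟨fun _ _ _ ↦ ⟨hle _ _, hle _ _⟩, fun _ _ _ ↦ ⟨hle _ _, hle _ _⟩⟩
  have hCpos : IsStrictlyPositive C := hC ▸ hA.conj_rpow hB _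
  have hBC : A ^ (1 / 2 : ℝ) * C * A ^ (1 / 2 : ℝ) = B := by
    rw [hC, hA.conj_rpow_neg_conj_rpow]
  have hom := hh.operatorMonotone
  have hcont := hom.continuousOn
  have hpos := hh.pos
  have hhC := hom.continuousOn_spectrum hCpos
  have hhC0 : ∀ t ∈ spectrum ℝ C, 0 < h t := fun t ht ↦ hpos t (hCpos.spectrum_pos ht)
  have hhCpos : IsStrictlyPositive (cfc h C) :=
    (cfc_isStrictlyPositive_iff h C hhC hCpos.isSelfAdjoint).2 hhC0
  have hmean : operatorMean h A B = A ^ (1 / 2 : ℝ) * cfc h C * A ^ (1 / 2 : ℝ) := by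
    rw [operatorMean_def, ← hC]
  have hMpos : IsStrictlyPositive (operatorMean h A B) := hmean ▸ hA.conj_rpow hhCpos _
  have hnorm : 0 < ‖operatorMean h A B‖ := norm_pos_iff.2 hMpos.isUnit.ne_zero
  have hmin := hMpos.lambdaMin_pos
  have hup : A ≤ cfc (fun t ↦ ‖operatorMean h A B‖ * (h t)⁻¹) C := by
    rw [← smul_cfc_rpow_neg_one hcont hpos hCpos]
    exact hA.le_smul_rpow_neg_one hhCpos
      (hmean ▸ hMpos.isSelfAdjoint.le_algebraMap_norm_self)
  have hlow : cfc (fun t ↦ lambdaMin (operatorMean h A B) * (h t)⁻¹) C ≤ A := by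
    rw [← smul_cfc_rpow_neg_one hcont hpos hCpos]
    exact hA.smul_rpow_neg_one_le hhCpos
      (hmean ▸ hMpos.isSelfAdjoint.algebraMap_lambdaMin_le)
  have hgc (r : ℝ) : ContinuousOn (fun t ↦ r * (h t)⁻¹) (spectrum ℝ C) :=
    continuousOn_const.mul (hhC.inv₀ fun t ht ↦ (hhC0 t ht).ne')
  have hg0 {r : ℝ} (hr : 0 < r) : ∀ t ∈ spectrum ℝ C, 0 < r * (h t)⁻¹ := fun t ht ↦
    mul_pos hr (inv_pos.2 (hhC0 t ht))
  have hgpos {r : ℝ} (hr : 0 < r) : IsStrictlyPositive (cfc (fun t ↦ r * (h t)⁻¹) C) :=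
    (cfc_isStrictlyPositive_iff _ C (hgc r) hCpos.isSelfAdjoint).2 (hg0 hr)
  have hsA := IsStrictlyPositive.isSelfAdjoint_rpow A (1 / 2)
  have hident (p : ℝ) := operatorMean_rpow hcont hA hCpos (p - 1)
  simp only [sub_add_cancel, hBC] at hident
  have hfc (r p : ℝ) (hr : 0 < r) := reducedMean_cfc hcont hCpos (hgc r) (hg0 hr) (p - 1)
  have hfcont (r p : ℝ) (hr : 0 < r) :
      ContinuousOn (fun t ↦ (r * (h t)⁻¹) ^ (p - 1) * h (t ^ (p - 1 + 1))) (spectrum ℝ C) := by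
    refine ((hgc r).rpow_const fun t ht ↦ Or.inl (hg0 hr t ht).ne').mul (hcont.comp
      (continuousOn_id.rpow_const fun t ht ↦ Or.inl (hCpos.spectrum_pos ht).ne')
      fun t ht ↦ Real.rpow_pos_of_pos (hCpos.spectrum_pos ht) _)
  have hconj (c : ℝ) : A ^ (1 / 2 : ℝ) * cfc (fun t ↦ c * h t) C * A ^ (1 / 2 : ℝ) =
      c • operatorMean h A B := by
    rw [cfc_const_mul c h C hhC, hmean, mul_smul_comm, smul_mul_assoc]
  -- In this and the next claim r stands for either ‖A σ B‖ or λ_min(A σ B), so both ranges of p are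
  -- covered at once.
  have upper {p r : ℝ} (hr : 0 < r)
      (hle : reducedMean h (p - 1) C A ≤
        reducedMean h (p - 1) C (cfc (fun t ↦ r * (h t)⁻¹) C)) :
      operatorMean h (A ^ p) (B ^ p) ≤
        (‖powerQuotient h p C‖ * r ^ (p - 1)) • operatorMean h A B := by
    rw [hident, ← hconj]
    refine hsA.conjugate_le_conjugate ((hle.trans_eq (hfc r p hr)).trans ?_)
    refine cfc_mono (fun t ht ↦ ?_) (hfcont r p hr) (continuousOn_const.mul hhC)
    rw [mul_inv_rpow_mul hr (hhC0 t ht), sub_add_cancel, mul_comm ‖powerQuotient h p C‖]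
    have := le_norm_powerQuotient hcont hpos hCpos p ht
    have := hhC0 t ht
    gcongr
  have lower {p r : ℝ} (hr : 0 < r)
      (hle : reducedMean h (p - 1) C (cfc (fun t ↦ r * (h t)⁻¹) C) ≤
        reducedMean h (p - 1) C A) :
      (lambdaMin (powerQuotient h p C) * r ^ (p - 1)) • operatorMean h A B ≤
        operatorMean h (A ^ p) (B ^ p) := by
    rw [hident, ← hconj]
    refine hsA.conjugate_le_conjugate (le_trans ?_ ((hfc r p hr).symm.trans_le hle))
    refine cfc_mono (fun t ht ↦ ?_) (continuousOn_const.mul hhC) (hfcont r p hr)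
    rw [mul_inv_rpow_mul hr (hhC0 t ht), sub_add_cancel, mul_comm (lambdaMin (powerQuotient h p C))]
    have := lambdaMin_powerQuotient_le hcont hpos hCpos p ht
    have := hhC0 t ht
    gcongr
  -- For p ≤ 1 the reduced mean is antitone in A, so the norm and the spectral minimum exchange
  -- roles.
  refine ⟨fun p hp1 hp2 ↦ ⟨lower hmin ?_, upper hnorm ?_⟩,
    fun p hp0 hp1 ↦ ⟨upper hmin ?_, lower hnorm ?_⟩⟩
  · exact hom.reducedMean_mono hpos (hgpos hmin) hCpos hlow (by linarith) (by linarith)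
  · exact hom.reducedMean_mono hpos hA hCpos hup (by linarith) (by linarith)
  · exact hom.reducedMean_anti hpos (hgpos hmin) hCpos hlow (by linarith) (by linarith)
  · exact hom.reducedMean_anti hpos hA hCpos hup (by linarith) (by linarith)
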